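/- **Conventions.** For an infinite cardinal $\kappa$, $\kappa^{+m}$ is the $m$-th successor of $\kappa$. For infinite cardinals $\chi\le\lambda$, the principle $\square_\lambda(\sqsubseteq_\chi)$ states that there is a sequence $\langle C_\alpha \mid \alpha<\lambda^+,\ \mathrm{cf}(\alpha)\ge\chi\rangle$ such that (i) $C_\alpha$ is a closed and unbounded subset of $\alpha$; (ii) $\mathrm{otp}(C_\alpha)\le\lambda$; (iii) if $\beta$ is a limit point of $C_\alpha$ and $\mathrm{cf}(\beta)\ge\chi$, then $C_\beta=C_\alpha\cap\beta$. For $k\in\omega$ let $M_k$ be the join-semilattice with $k+1$ elements $0,\dots,k-1,\mathbf 1$ in which any two distinct elements have join $\mathbf 1$. An *$(n,\kappa)$-semiladder* is a nonempty join-semilattice that has no join-subsemilattice isomorphic to $M_{n+1}$ and all of whose principal ideals have cardinality $<\kappa$. Let $B$ be a join-semilattice with least element $\mathbf 0_B$, $\gamma$ an ordinal and $\varrho:[\gamma]^2\to B$; write $\varrho(\alpha,\beta)$ for $\varrho(\{\alpha,\beta\})$ when $\alpha<\beta$, and put $\varrho(\alpha,\alpha)=\mathbf 0_B$. On $\gamma\times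 B$ let $(\alpha,p)\trianglelefteq_\varrho(\beta,q)$ if and only if $\alpha\le\beta$ and $p\vee\varrho(\alpha,\beta)\le q$. A *special $(0,\kappa)$-semiladder* is a one-point join-semilattice. A *special $(n+1,\kappa)$-semiladder* is an $(n+1,\kappa)$-semiladder which is (up to isomorphism) of the form $(\gamma\times B,\trianglelefteq_\varrho)$, where $\gamma$ is an ordinal, $B$ is a special $(n,\kappa)$-semiladder, and $\varrho:[\gamma]^2\to B$ satisfies $\varrho(0,\alpha)=\mathbf 0_B$ for all $\alpha<\gamma$. Such a $\varrho$ is automatically transitive and subadditive, that is, $\varrho(\alpha,\delta)\le\varrho(\alpha,\beta)\vee\varrho(\beta,\delta)$ and $\varrho(\alpha,\beta)\le\varrho(\alpha,\delta)\vee\varrho(\beta,\delta)$ whenever $\alpha<\beta<\delta<\gamma$. **Theorem.** 1. Let $\kappa$ be a singular cardinal and $n\in\omega$. If $\square_{\kappa^{+m}}(\sqsubseteq_{\mathrm{cf}(\kappa)})$ holds for every $m<n$, then there exists an $(n+1,\kappa)$-semiladder of cardinality $\kappa^{+n}$. 2. More generally, let $\kappa$ be any infinite cardinal and $n\in\omega$.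 If $\square_{\kappa^{+m}}(\sqsubseteq_{\mathrm{cf}(\kappa)})$ holds for every $m<n$, then there exists a special $(n+1,\kappa)$-semiladder of cardinality $\kappa^{+n}$. -/

import Mathlib

open Cardinal Ordinal Set Topology

universe u v

/-- `P` is `M_n`-free: it has no join-subsemilattice isomorphic to the join-semilattice `M_n` with
`n + 1` elements `0, …, n - 1, 1` in which any two distinct elements have join the top element `1`.
Here `t` is the image of the top element and `x i` is the image of `i < n`. -/
def MFree (n : ℕ) (P : Type v) [SemilatticeSup P] : Prop :=
  ¬ ∃ (t : P) (x : Fin n → P), Function.Injective x ∧ (∀ i, x i < t) ∧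
    ∀ i j, i ≠ j → x i ⊔ x j = t

/-- `P` is an `(n, κ)`-semiladder: a nonempty, `M_{n+1}`-free join-semilattice whose principal
ideals have cardinality `< κ`. -/
structure IsSemiladder (n : ℕ) (κ : Cardinal.{v}) (P : Type v) [SemilatticeSup P] : Prop where
  nonempty : Nonempty P
  mfree : MFree (n + 1) P
  card_Iic_lt : ∀ p : P, #(Iic p) < κ

/-- `ρ(α, δ) ≤ ρ(α, β) ∨ ρ(β, δ)` for all `α < β < δ`. -/
def TransitiveMap {A : Type u} {B : Type v} [LinearOrder A] [SemilatticeSup B]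
    (ρ : A → A → B) : Prop :=
  ∀ α β δ, α < β → β < δ → ρ α δ ≤ ρ α β ⊔ ρ β δ

/-- `ρ(α, β) ≤ ρ(α, δ) ∨ ρ(β, δ)` for all `α < β < δ`. -/
def SubadditiveMap {A : Type u} {B : Type v} [LinearOrder A] [SemilatticeSup B]
    (ρ : A → A → B) : Prop :=
  ∀ α β δ, α < β → β < δ → ρ α β ≤ ρ α δ ⊔ ρ β δ

/-- The relation on `A × B` induced by `ρ`:
`(α, p) ⊴ (β, q)` iff `α ≤ β` and `p ∨ ρ(α, β) ≤ q`. -/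
def InducedLE {A : Type u} {B : Type v} [LinearOrder A] [SemilatticeSup B]
    (ρ : A → A → B) (x y : A × B) : Prop :=
  x.1 ≤ y.1 ∧ x.2 ⊔ ρ x.1 y.1 ≤ y.2

/-- Special `(n, κ)`-semiladders, by recursion on `n` (up to isomorphism). A special
`(0, κ)`-semiladder is a one-point join-semilattice. A special `(n + 1, κ)`-semiladder is an
`(n + 1, κ)`-semiladder of the form `(γ × B, ⊴_ρ)` where `γ` is an ordinal, `B` is a special
`(n, κ)`-semiladder and `ρ : [γ]² → B` satisfies `ρ(0, α) = 0_B` for all `α < γ`.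

The map `ρ` is written as a function of two variables, of which only the values `ρ α β` with
`α ≤ β` are ever used, with the convention `ρ(α, α) = 0_B`. Transitivity and subadditivity of `ρ`
are automatic, since `(γ × B, ⊴_ρ)` is a join-semilattice; they are listed to make them visible. -/
def IsSpecialSemiladder (κ : Cardinal.{u}) : ℕ → ∀ (S : Type u), SemilatticeSup S → Prop
  | 0, S, _ => Nonempty S ∧ Subsingleton S
  | n + 1, S, _ =>
    IsSemiladder (n + 1) κ S ∧
    ∃ (γ : Ordinal.{u}) (B : Type u) (iB : SemilatticeSup B), IsSpecialSemiladder κ n B iB ∧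
    ∃ ρ : Iio γ → Iio γ → B,
      TransitiveMap ρ ∧ SubadditiveMap ρ ∧
      (∀ α, IsBot (ρ α α)) ∧
      (∀ o α : Iio γ, o.1 = 0 → IsBot (ρ o α)) ∧
      ∃ e : S ≃ Iio γ × B, ∀ x y : S, x ≤ y ↔ InducedLE ρ (e x) (e y)

/-- The principle `□_l(⊑_χ)`, for infinite cardinals `χ ≤ l`: there is a sequence
`⟨C α | α < l⁺, cf(α) ≥ χ⟩` such that `C α` is a closed unbounded subset of `α` of order type
at most `l`, and `C β = C α ∩ β` for every limit point `β` of `C α` with `cf(β) ≥ χ`.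
(The values of `C` at other ordinals are irrelevant.) -/
def SquareLeft (l χ : Cardinal.{u}) : Prop :=
  ∃ C : Ordinal.{u} → Set Ordinal.{u},
    ∀ α < (Order.succ l).ord, χ ≤ α.cof →
      -- a subset of `α`, closed in `α` and unbounded in `α`
      C α ⊆ Iio α ∧
      (∀ β < α, AccPt β (Filter.principal (C α)) → β ∈ C α) ∧
      (∀ β < α, ∃ ξ ∈ C α, β ≤ ξ) ∧
      -- the order type of `C α` (an ordinal of the next universe) is at most `l`
      Ordinal.type (fun a b : C α => a < b) ≤ Ordinal.lift.{u + 1} l.ord ∧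
      -- coherence
      (∀ β, AccPt β (Filter.principal (C α)) → χ ≤ β.cof → C β = C α ∩ Iio β)

/-- The `n`-th successor `κ^{+n}` of a cardinal. -/
noncomputable def succPow (κ : Cardinal.{u}) (n : ℕ) : Cardinal.{u} := Order.succ^[n] κ

-- The proof is an induction on `n` that carries two extra properties of the semiladder: a least
-- element, and upper bounds for all subsets of size less than χ = cf(κ). Given such a `B` of size λ
-- = κ^{+n}, the next semiladder is λ⁺ × B ordered by `InducedLE ρ`. What is needed is a transitive
-- and subadditive ρ such that, for each γ and q, fewer than κ many α ≤ γ satisfy ρ(α, γ) ≤ q; this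
-- keeps principal ideals small (`IsDirectedSemiladder.exists_succ`). The new coordinate raises the
-- freeness index by only one (`IsTransitiveSubadditive.mfree`).
--
-- The map ρ comes from walks on ordinals along a square sequence: ρ(α, γ) is the join of the
-- weights of the steps from γ down to α. Each weight lies above a label `τ X` that is injective
-- along each `C γ`, so only few steps have weight below a given q (`mk_walkDist_le_lt`). It also
-- bounds the data at a set of fewer than χ control points, which exists in `B` by directedness.
-- Every other point of `C γ` below the target of the step is handled by coherence at a limit point
-- of cofinality at least χ. This yields transitivity and subadditivity by induction on γ
-- (`walkDist_transitive_subadditive`).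

section Walk

-- Walks along a C-sequence and their distance function

variable {A : Type v} {B : Type u} [LinearOrder A]

/-- `D` is a set of points below `d`, small in that its images in `B` are bounded, which controls
`X`: every point of `X` either belongs to
`D`, or lies below a point `e ∈ D ∪ {d}` at which the `C`-sequence coheres with `X`. -/
def IsControl (B : Type u) [SemilatticeSup B] (C : A → Set A) (X : Set A) (d : A) (D : Set A) :
    Prop :=
  D ⊆ Iio d ∧ (∀ f : A → B, BddAbove (f '' D)) ∧
    ∀ c ∈ X, c ∈ D ∨ ∃ e, c < e ∧ (e = d ∨ e ∈ D) ∧ C e = X ∩ Iio e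

open Classical in
/-- A chosen control set, if there is one. -/
noncomputable def controlSet (B : Type u) [SemilatticeSup B] (C : A → Set A) (X : Set A) (d : A) :
    Set A :=
  if h : ∃ D, IsControl B C X d D then h.choose else ∅

theorem isControl_controlSet [SemilatticeSup B] {C : A → Set A} {X : Set A} {d : A}
    (h : ∃ D, IsControl B C X d D) : IsControl B C X d (controlSet B C X d) := by
  rw [controlSet, dif_pos h]
  exact h.choose_spec

open Classical in
/-- A chosen upper bound, if there is one. -/
noncomputable def chosenUB [SemilatticeSup B] [OrderBot B] (Y : Set B) : B :=
  if h : BddAbove Y then h.choose else ⊥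

theorem le_chosenUB [SemilatticeSup B] [OrderBot B] {Y : Set B} (h : BddAbove Y) {b : B}
    (hb : b ∈ Y) : b ≤ chosenUB Y := by
  rw [chosenUB, dif_pos h]
  exact h.choose_spec hb

theorem inter_Iio_inter_Iio {X : Set A} {c d : A} (h : c ≤ d) :
    X ∩ Iio d ∩ Iio c = X ∩ Iio c := by
  rw [inter_assoc, Iio_inter_Iio, min_eq_right h]

variable [WellFoundedLT A] [SemilatticeSup B] [OrderBot B] (C : A → Set A) (τ : Set A → B)

attribute [local instance] WellFoundedLT.toWellFoundedRelation

open Classical in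
mutual

/-- The weight of the step from a point `γ` with `C γ ∩ d = X` down to `d ∈ C γ`. -/
noncomputable def stepWeight (X : Set A) (d : A) : B :=
  -- The weight depends only on `X` and `d`, so points whose C-sets have the same trace below `d`
  -- give the step to `d` the same weight.
  chosenUB ({τ X} ∪ ({b | ∃ x, ∃ _ : x < d, x ∈ controlSet B C X d ∧ b = walkDist x d} ∪
    {b | ∃ x, ∃ _ : x < d, x ∈ controlSet B C X d ∧ b = stepWeight (X ∩ Iio x) x}))
-- The second component breaks the tie: the weight of a step to `d` calls walks starting at `d`,
-- which only use steps to smaller points.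
termination_by (d, 1)

/-- The join of the weights of all steps of the walk from `γ` down to `α` along `C`. -/
noncomputable def walkDist (α γ : A) : B :=
  if h : ∃ c, c ∈ C γ ∧ α ≤ c ∧ c < γ then
    walkDist α (wellFounded_lt.min {c | c ∈ C γ ∧ α ≤ c ∧ c < γ} h) ⊔
      stepWeight (C γ ∩ Iio (wellFounded_lt.min {c | c ∈ C γ ∧ α ≤ c ∧ c < γ} h))
        (wellFounded_lt.min {c | c ∈ C γ ∧ α ≤ c ∧ c < γ} h)
  else ⊥
termination_by (γ, 0)
decreasing_by
  · exact Prod.Lex.left _ _ (wellFounded_lt.min_mem {c | c ∈ C γ ∧ α ≤ c ∧ c < γ} h).2.2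
  · exact Prod.Lex.left _ _ (wellFounded_lt.min_mem {c | c ∈ C γ ∧ α ≤ c ∧ c < γ} h).2.2

end

theorem walkDist_eq_bot {α γ : A} (h : γ ≤ α) : walkDist C τ α γ = ⊥ := by
  rw [walkDist, dif_neg]
  rintro ⟨c, -, h1, h2⟩
  exact absurd (h.trans h1) (not_le.2 h2)

theorem walkDist_eq {α γ c : A} (hc : c ∈ C γ) (hα : α ≤ c) (hγ : c < γ)
    (hmin : ∀ x ∈ C γ, α ≤ x → c ≤ x) :
    walkDist C τ α γ = walkDist C τ α c ⊔ stepWeight C τ (C γ ∩ Iio c) c := by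
  have h : ∃ c, c ∈ C γ ∧ α ≤ c ∧ c < γ := ⟨c, hc, hα, hγ⟩
  have e : wellFounded_lt.min {c | c ∈ C γ ∧ α ≤ c ∧ c < γ} h = c := by
    have := wellFounded_lt.min_mem {c | c ∈ C γ ∧ α ≤ c ∧ c < γ} h
    refine le_antisymm (not_lt.1 (wellFounded_lt.not_lt_min _ ?_)) (hmin _ this.1 this.2.1)
    exact ⟨hc, hα, hγ⟩
  rw [walkDist, dif_pos h, e]

theorem walkDist_of_mem {γ c : A} (hc : c ∈ C γ) (hγ : c < γ) :
    walkDist C τ c γ = stepWeight C τ (C γ ∩ Iio c) c := by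
  rw [walkDist_eq C τ hc le_rfl hγ fun _ _ h => h, walkDist_eq_bot C τ le_rfl, bot_sup_eq]

theorem exists_least_ge {γ α : A} (hcof : ∀ α < γ, ∃ ξ ∈ C γ, α ≤ ξ) (hα : α < γ) :
    ∃ c ∈ C γ, α ≤ c ∧ ∀ x ∈ C γ, α ≤ x → c ≤ x := by
  have h : {c | c ∈ C γ ∧ α ≤ c}.Nonempty := hcof α hα
  obtain ⟨h1, h2⟩ := wellFounded_lt.min_mem _ h
  refine ⟨_, h1, h2, fun x hx hx' => not_lt.1 ?_⟩
  exact wellFounded_lt.not_lt_min {c | c ∈ C γ ∧ α ≤ c} (x := x) ⟨hx, hx'⟩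

variable {C}

theorem bddAbove_stepWeight {X : Set A} {d : A} (h : ∃ D, IsControl B C X d D) :
    BddAbove ({τ X} ∪ ({b | ∃ x, ∃ _ : x < d, x ∈ controlSet B C X d ∧ b = walkDist C τ x d} ∪
      {b | ∃ x, ∃ _ : x < d, x ∈ controlSet B C X d ∧ b = stepWeight C τ (X ∩ Iio x) x})) := by
  obtain ⟨-, hb, -⟩ := isControl_controlSet h
  refine bddAbove_singleton.union (.union ?_ ?_)
  · refine (hb fun x => walkDist C τ x d).mono ?_
    rintro _ ⟨x, _, hx, rfl⟩
    exact ⟨x, hx, rfl⟩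
  · refine (hb fun x => stepWeight C τ (X ∩ Iio x) x).mono ?_
    rintro _ ⟨x, _, hx, rfl⟩
    exact ⟨x, hx, rfl⟩

theorem le_stepWeight {X : Set A} {d : A} (h : ∃ D, IsControl B C X d D) :
    τ X ≤ stepWeight C τ X d := by
  rw [stepWeight]
  exact le_chosenUB (bddAbove_stepWeight τ h) (.inl rfl)

theorem walkDist_le_stepWeight {X : Set A} {d : A} (h : ∃ D, IsControl B C X d D)
    {x : A} (hx : x ∈ controlSet B C X d) :
    walkDist C τ x d ≤ stepWeight C τ X d := by
  rw [stepWeight]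
  exact le_chosenUB (bddAbove_stepWeight τ h)
    (.inr (.inl ⟨x, (isControl_controlSet h).1 hx, hx, rfl⟩))

theorem stepWeight_le_stepWeight {X : Set A} {d : A} (h : ∃ D, IsControl B C X d D)
    {x : A} (hx : x ∈ controlSet B C X d) :
    stepWeight C τ (X ∩ Iio x) x ≤ stepWeight C τ X d := by
  rw [stepWeight.eq_1 C τ X d]
  exact le_chosenUB (bddAbove_stepWeight τ h)
    (.inr (.inr ⟨x, (isControl_controlSet h).1 hx, hx, rfl⟩))

/-- The hypotheses on a `C`-sequence below `L` needed for the walk distance to be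
transitive and subadditive. -/
structure IsControlled (B : Type u) [SemilatticeSup B] (C : A → Set A) (L : A) : Prop where
  subset : ∀ γ < L, C γ ⊆ Iio γ
  cofinal : ∀ γ < L, ∀ α < γ, ∃ ξ ∈ C γ, α ≤ ξ
  control : ∀ γ < L, ∀ d ∈ C γ, ∃ D, IsControl B C (C γ ∩ Iio d) d D

variable {L : A}

/-- Comparison of the weights of two steps from the same point. -/
theorem walkDist_steps (hC : IsControlled B C L) {γ : A} (hγ : γ < L)
    (ih : ∀ δ < γ, ∀ α β, α ≤ β → β ≤ δ →
      walkDist C τ α δ ≤ walkDist C τ α β ⊔ walkDist C τ β δ ∧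
      walkDist C τ α β ≤ walkDist C τ α δ ⊔ walkDist C τ β δ)
    {α c d : A} (hc : c ∈ C γ) (hd : d ∈ C γ) (hcd : c < d) (hα : α ≤ c)
    (hmin : ∀ x ∈ C γ, α ≤ x → c ≤ x) :
    walkDist C τ c d ≤ walkDist C τ α d ⊔ walkDist C τ d γ ∧
    walkDist C τ c γ ≤ walkDist C τ c d ⊔ walkDist C τ d γ ∧
    walkDist C τ c d ≤ walkDist C τ c γ ⊔ walkDist C τ d γ := by
  have hdγ := hC.subset γ hγ hd
  have hcγ := hC.subset γ hγ hc
  have hctl := hC.control γ hγ d hd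
  rw [walkDist_of_mem C τ hd hdγ]
  obtain ⟨-, -, h3⟩ := isControl_controlSet hctl
  -- If `c` is a control point, the weight of the step to `d` dominates both `walkDist C τ c d` and
  -- the weight of the step to `c`.
  rcases h3 c ⟨hc, hcd⟩ with hD | ⟨e, hce, he, hCe⟩
  · have h1 := walkDist_le_stepWeight τ hctl hD
    have h2 := stepWeight_le_stepWeight τ hctl hD
    rw [inter_Iio_inter_Iio hcd.le, ← walkDist_of_mem C τ hc hcγ] at h2
    exact ⟨le_sup_of_le_right h1, le_sup_of_le_right h2, le_sup_of_le_right h1⟩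
  -- Otherwise `C e` and `C γ` agree below `e`, so the walk from `e` to `α` also steps to `c` first,
  -- with the same weight. Thus `e` replaces `γ`, and the induction hypothesis at `d` applies.
  · have hed : e ≤ d := by
      rcases he with rfl | he
      · exact le_rfl
      · exact ((isControl_controlSet hctl).1 he).le
    have hes : walkDist C τ e d ≤ stepWeight C τ (C γ ∩ Iio d) d := by
      rcases he with rfl | he
      · rw [walkDist_eq_bot C τ le_rfl]
        exact bot_le
      · exact walkDist_le_stepWeight τ hctl he
    rw [inter_Iio_inter_Iio hed] at hCe
    have hcCe : c ∈ C e := hCe ▸ ⟨hc, hce⟩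
    have hw : stepWeight C τ (C e ∩ Iio c) c = stepWeight C τ (C γ ∩ Iio c) c := by
      rw [hCe, inter_Iio_inter_Iio hce.le]
    have e1 : walkDist C τ c e = walkDist C τ c γ := by
      rw [walkDist_of_mem C τ hcCe hce, walkDist_of_mem C τ hc hcγ, hw]
    have e2 : walkDist C τ c e ≤ walkDist C τ α e := by
      rw [walkDist_of_mem C τ hcCe hce, walkDist_eq C τ hcCe hα hce fun x hx => ?_]
      · exact le_sup_right
      · rw [hCe] at hx
        exact hmin x hx.1
    have i1 := ih d hdγ c e hce.le hed
    have i2 := ih d hdγ α e (hα.trans hce.le) hed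
    refine ⟨?_, ?_, ?_⟩
    · calc _ ≤ _ := i1.1
        _ ≤ walkDist C τ α e ⊔ _ := sup_le_sup_right e2 _
        _ ≤ (walkDist C τ α d ⊔ walkDist C τ e d) ⊔ walkDist C τ e d := sup_le_sup_right i2.2 _
        _ ≤ _ := by rw [sup_assoc, sup_idem]; exact sup_le_sup_left hes _
    · rw [← e1]
      exact i1.2.trans (sup_le_sup_left hes _)
    · rw [← e1]
      exact i1.1.trans (sup_le_sup_left hes _)

theorem walkDist_transitive_subadditive (hC : IsControlled B C L) (γ : A) (hγ : γ < L) (α β : A)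
    (hαβ : α ≤ β) (hβγ : β ≤ γ) :
    walkDist C τ α γ ≤ walkDist C τ α β ⊔ walkDist C τ β γ ∧
    walkDist C τ α β ≤ walkDist C τ α γ ⊔ walkDist C τ β γ := by
  induction γ using WellFoundedLT.induction generalizing α β with
  | ind γ IH =>
  have ih : ∀ δ < γ, ∀ α β, α ≤ β → β ≤ δ →
      walkDist C τ α δ ≤ walkDist C τ α β ⊔ walkDist C τ β δ ∧
      walkDist C τ α β ≤ walkDist C τ α δ ⊔ walkDist C τ β δ :=
    fun δ hδ α β h1 h2 => IH δ hδ (hδ.trans hγ) α β h1 h2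
  rcases hβγ.eq_or_lt with rfl | hβ
  · exact ⟨le_sup_left, le_sup_left⟩
  obtain ⟨c, hc, hαc, hcmin⟩ := exists_least_ge C (hC.cofinal γ hγ) (hαβ.trans_lt hβ)
  obtain ⟨d, hd, hβd, hdmin⟩ := exists_least_ge C (hC.cofinal γ hγ) hβ
  have hcγ := hC.subset γ hγ hc
  have hdγ := hC.subset γ hγ hd
  have eα := walkDist_eq C τ hc hαc hcγ hcmin
  have eβ := walkDist_eq C τ hd hβd hdγ hdmin
  rw [← walkDist_of_mem C τ hc hcγ] at eα
  rw [← walkDist_of_mem C τ hd hdγ] at eβ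
  rw [eα, eβ]
  have hcd : c ≤ d := hcmin d hd (hαβ.trans hβd)
  obtain ⟨i1, i2⟩ := ih d hdγ α β hαβ hβd
  rcases hcd.eq_or_lt with rfl | hcd
  · refine ⟨?_, ?_⟩
    · rw [← sup_assoc]
      exact sup_le_sup_right i1 _
    · exact i2.trans (sup_le_sup le_sup_left le_sup_left)
  -- A point of `C γ` in the interval [β, d) would contradict the minimality of `d`.
  have hcβ : c ≤ β := by
    by_contra! h
    exact absurd (hdmin c hc h.le) (not_le.2 hcd)
  obtain ⟨s1, s2, s3⟩ := walkDist_steps τ hC hγ ih hc hd hcd hαc hcmin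
  obtain ⟨j1, j2⟩ := ih d hdγ α c hαc hcd.le
  have hmain : walkDist C τ α d ≤ walkDist C τ α β ⊔ (walkDist C τ β d ⊔ walkDist C τ d γ) :=
    i1.trans (sup_le_sup_left le_sup_left _)
  have hdr : walkDist C τ d γ ≤ walkDist C τ α β ⊔ (walkDist C τ β d ⊔ walkDist C τ d γ) :=
    le_sup_of_le_right le_sup_right
  have hcd' := s1.trans (sup_le hmain hdr)
  refine ⟨sup_le (j2.trans (sup_le hmain hcd')) (s2.trans (sup_le hcd' hdr)), ?_⟩
  obtain ⟨k1, -⟩ := ih β hβ α c hαc hcβ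
  obtain ⟨-, k2⟩ := ih d hdγ c β hcβ hβd
  refine k1.trans (sup_le (le_sup_of_le_left le_sup_left) (k2.trans (sup_le (s3.trans ?_) ?_)))
  · exact sup_le (le_sup_of_le_left le_sup_right) (le_sup_of_le_right le_sup_right)
  · exact le_sup_of_le_right le_sup_left

end Walk

-- Local smallness of the walk distance

theorem mk_walkDist_le_lt {A : Type v} {B : Type u} [LinearOrder A] [WellFoundedLT A]
    [SemilatticeSup B] [OrderBot B] {C : A → Set A} {τ : Set A → B} {L : A}
    (hC : IsControlled B C L) {θ : Cardinal.{v}} (hθ : θ.IsRegular) {q : B}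
    (hτ : ∀ γ < L, #{c | c ∈ C γ ∧ τ (C γ ∩ Iio c) ≤ q} < θ) (γ : A) (hγ : γ < L) :
    #{α | α < γ ∧ walkDist C τ α γ ≤ q} < θ := by
  induction γ using WellFoundedLT.induction with
  | ind γ ih =>
  -- A walk of distance at most `q` has a first step whose label is at most `q`, and the rest of the
  -- walk has distance at most `q` as well.
  have hsub : {α | α < γ ∧ walkDist C τ α γ ≤ q} ⊆
      ⋃ c ∈ {c | c ∈ C γ ∧ τ (C γ ∩ Iio c) ≤ q}, insert c {α | α < c ∧ walkDist C τ α c ≤ q} := by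
    rintro α ⟨hα, hq⟩
    obtain ⟨c, hc, hαc, hmin⟩ := exists_least_ge C (hC.cofinal γ hγ) hα
    rw [walkDist_eq C τ hc hαc (hC.subset γ hγ hc) hmin, sup_le_iff] at hq
    simp only [mem_iUnion]
    refine ⟨c, ⟨hc, (le_stepWeight τ (hC.control γ hγ c hc)).trans hq.2⟩, ?_⟩
    rcases hαc.eq_or_lt with rfl | h
    · exact mem_insert _ _
    · exact mem_insert_of_mem _ ⟨h, hq.1⟩
  refine (mk_le_mk_of_subset hsub).trans_lt ?_
  rw [card_biUnion_lt_iff_forall_of_isRegular hθ (hτ γ hγ)]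
  rintro c ⟨hc, -⟩
  have hcγ := hC.subset γ hγ hc
  exact mk_insert_le.trans_lt (add_lt_of_lt hθ.aleph0_le (ih c hcγ (lt_trans hcγ hγ))
    (one_lt_aleph0.trans_le hθ.aleph0_le))

-- Limit points of large cofinality and small control sets

theorem exists_cofinal_mk_eq_cof (ε : Ordinal.{u}) :
    ∃ K ⊆ Iio ε, #K = Cardinal.lift.{u + 1} ε.cof ∧ ∀ a < ε, ∃ k ∈ K, a ≤ k := by
  obtain ⟨s, hs, hcard⟩ := Order.exists_cof_eq (Iio ε)
  refine ⟨Subtype.val '' s, ?_, ?_, ?_⟩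
  · rintro _ ⟨x, -, rfl⟩
    exact x.2
  · rw [mk_image_eq Subtype.val_injective, hcard, cof_Iio, lift_cof]
  · intro a ha
    obtain ⟨k, hk, hak⟩ := hs ⟨a, ha⟩
    exact ⟨k, ⟨k, hk, rfl⟩, hak⟩

/-- A bounded set of ordinals without limit points `ε ∉ E` of cofinality at least `χ` above all its
elements has a cofinal subset of size `< χ`. -/
theorem exists_small_cofinal_subset {χ : Cardinal.{u}} (hχ : ℵ₀ ≤ χ) {E : Set Ordinal.{u}}
    {d : Ordinal.{u}} (hE : ∀ e ∈ E, e ≤ d)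
    (hlim : ∀ ε ≤ d, χ ≤ ε.cof → (∀ e ∈ E, e < ε) → ¬ ∀ a < ε, ∃ e ∈ E, a < e) :
    ∃ D ⊆ E, #D < Cardinal.lift.{u + 1} χ ∧ ∀ e ∈ E, ∃ x ∈ D, e ≤ x := by
  have hne : {ε : Ordinal.{u} | ∀ e ∈ E, e < ε}.Nonempty :=
    ⟨Order.succ d, fun e he => Order.lt_succ_of_le (hE e he)⟩
  -- `ε` is the least strict upper bound of `E`. If its cofinality is at least `χ`, it is a limit of
  -- `E`, contrary to `hlim`; otherwise a short cofinal set in `ε` is pushed into `E`.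
  obtain ⟨ε, hε, hmin⟩ : ∃ ε : Ordinal.{u}, (∀ e ∈ E, e < ε) ∧ ∀ a < ε, ∃ e ∈ E, a ≤ e := by
    refine ⟨_, wellFounded_lt.min_mem _ hne, fun a ha => ?_⟩
    by_contra! h
    exact wellFounded_lt.not_lt_min {ε : Ordinal.{u} | ∀ e ∈ E, e < ε} (x := a) h ha
  by_cases hcof : χ ≤ ε.cof
  · exfalso
    have hl : Order.IsSuccLimit ε := one_lt_cof_iff.1 (one_lt_aleph0.trans_le (hχ.trans hcof))
    refine hlim ε ?_ hcof hε fun a ha => ?_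
    · by_contra! h
      obtain ⟨e, he, hde⟩ := hmin _ (hl.succ_lt h)
      exact absurd (hE e he) (not_le.2 (Order.succ_le_iff.1 hde))
    · obtain ⟨e, he, hae⟩ := hmin _ (hl.succ_lt ha)
      exact ⟨e, he, Order.succ_le_iff.1 hae⟩
  · obtain ⟨K, hK, hKc, hKcof⟩ := exists_cofinal_mk_eq_cof ε
    choose! f hf hf' using hmin
    refine ⟨f '' K, ?_, ?_, fun e he => ?_⟩
    · rintro _ ⟨k, hk, rfl⟩
      exact hf k (hK hk)
    · refine mk_image_le.trans_lt ?_
      rw [hKc, Cardinal.lift_lt]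
      exact not_le.1 hcof
    · obtain ⟨k, hk, hek⟩ := hKcof e (hε e he)
      exact ⟨f k, ⟨k, hk, rfl⟩, hek.trans (hf' k (hK hk))⟩

/-- A set of at least `χ` ordinals has a limit point of cofinality at least `χ`. -/
theorem exists_accumulation_of_le_mk {χ : Cardinal.{u}} (hχ : χ.IsRegular) {Y : Set Ordinal.{u}}
    {d : Ordinal.{u}} (hY : Y ⊆ Iio d) (hcard : Cardinal.lift.{u + 1} χ ≤ #Y) :
    ∃ ε ≤ d, χ ≤ ε.cof ∧ ∀ a < ε, ∃ y ∈ Y, a < y ∧ y < ε := by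
  have hreg : (Cardinal.lift.{u + 1} χ).IsRegular := hχ.lift
  have hd : Cardinal.lift.{u + 1} χ ≤ #↥(Y ∩ Iio d) := by rwa [inter_eq_left.2 hY]
  -- At the first `ε` with at least `χ` points of `Y` below it, a smaller cofinality would write `Y
  -- ∩ Iio ε` as a union of fewer than `χ` sets of size less than `χ`.
  obtain ⟨ε, hε, hmin⟩ : ∃ ε, Cardinal.lift.{u + 1} χ ≤ #↥(Y ∩ Iio ε) ∧
      ∀ a < ε, #↥(Y ∩ Iio a) < Cardinal.lift.{u + 1} χ := by
    have hne : {ε : Ordinal.{u} | Cardinal.lift.{u + 1} χ ≤ #↥(Y ∩ Iio ε)}.Nonempty := ⟨d, hd⟩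
    refine ⟨_, wellFounded_lt.min_mem _ hne, fun a ha => ?_⟩
    by_contra! h
    exact wellFounded_lt.not_lt_min _ (x := a) h ha
  have hmin' : ∀ a < ε, #↥(Y ∩ Iic a) < Cardinal.lift.{u + 1} χ := by
    intro a ha
    have : Y ∩ Iic a ⊆ insert a (Y ∩ Iio a) := by
      rintro x ⟨hx, hxa⟩
      rcases (mem_Iic.1 hxa).eq_or_lt with rfl | h
      · exact mem_insert _ _
      · exact mem_insert_of_mem _ ⟨hx, h⟩
    exact (mk_le_mk_of_subset this).trans_lt (mk_insert_le.trans_lt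
      (add_lt_of_lt hreg.aleph0_le (hmin a ha) (one_lt_aleph0.trans_le hreg.aleph0_le)))
  refine ⟨ε, ?_, ?_, fun a ha => ?_⟩
  · by_contra! h
    exact absurd hd (not_le.2 (hmin d h))
  · by_contra! h
    obtain ⟨K, hK, hKc, hKcof⟩ := exists_cofinal_mk_eq_cof ε
    have hsub : Y ∩ Iio ε ⊆ ⋃ k ∈ K, Y ∩ Iic k := by
      rintro x ⟨hx, hxε⟩
      obtain ⟨k, hk, hxk⟩ := hKcof x hxε
      simp only [mem_iUnion]
      exact ⟨k, hk, hx, hxk⟩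
    refine absurd hε (not_le.2 ((mk_le_mk_of_subset hsub).trans_lt ?_))
    rw [card_biUnion_lt_iff_forall_of_isRegular hreg (by rwa [hKc, Cardinal.lift_lt])]
    exact fun k hk => hmin' k (hK hk)
  · by_contra! h
    refine absurd hε (not_le.2 ((mk_le_mk_of_subset ?_).trans_lt (hmin' a ha)))
    rintro x ⟨hx, hxε⟩
    refine ⟨hx, ?_⟩
    by_contra hxa
    exact absurd hxε (not_lt.2 (h x hx (not_le.1 hxa)))

theorem accPt_of_forall_lt {X : Set Ordinal.{u}} {ε : Ordinal.{u}} (h0 : 0 < ε)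
    (h : ∀ a < ε, ∃ y ∈ X, a < y ∧ y < ε) : AccPt ε (Filter.principal X) := by
  rw [SuccOrder.accPt_principal]
  refine ⟨not_isMin_of_lt h0, fun b hb => ?_⟩
  obtain ⟨y, hy, h1, h2⟩ := h b hb
  exact ⟨y, hy, h1, h2⟩

/-- The control set joins a short cofinal set of limit points of cofinality at least χ with the
points of `X` beyond all of them. The latter are fewer than χ, since χ of them would accumulate at
another such limit point. -/
theorem exists_small_control {χ : Cardinal.{u}} (hχ : χ.IsRegular) {X : Set Ordinal.{u}}
    {d : Ordinal.{u}} (hX : X ⊆ Iio d) :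
    ∃ D ⊆ Iio d, #D < Cardinal.lift.{u + 1} χ ∧ ∀ c ∈ X, c ∈ D ∨
      ∃ e, c < e ∧ (e = d ∨ e ∈ D) ∧ AccPt e (Filter.principal X) ∧ χ ≤ e.cof := by
  have hpos : ∀ ε : Ordinal.{u}, χ ≤ ε.cof → 0 < ε := fun ε h => cof_pos.1 (hχ.pos.trans_le h)
  by_cases hd : AccPt d (Filter.principal X) ∧ χ ≤ d.cof
  · refine ⟨∅, empty_subset _, ?_, fun c hc => .inr ⟨d, hX hc, .inl rfl, hd⟩⟩
    rw [mk_eq_zero]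
    exact hχ.lift.pos
  set E : Set Ordinal.{u} := {e | e < d ∧ AccPt e (Filter.principal X) ∧ χ ≤ e.cof} with hE
  obtain ⟨D₁, hD₁, hc₁, hcof₁⟩ := exists_small_cofinal_subset (χ := χ) hχ.aleph0_le (E := E)
    (d := d) (fun e he => he.1.le) (by
      intro ε hεd hcof hlt hlim
      have hacc : AccPt ε (Filter.principal X) := by
        refine accPt_of_forall_lt (hpos ε hcof) fun a ha => ?_
        obtain ⟨e, he, hae⟩ := hlim a ha
        obtain ⟨y, hy, h1, h2⟩ := (SuccOrder.accPt_principal.1 he.2.1).2 a hae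
        exact ⟨y, hy, h1, h2.trans (hlt e he)⟩
      rcases hεd.eq_or_lt with rfl | h
      · exact hd ⟨hacc, hcof⟩
      · exact lt_irrefl ε (hlt ε ⟨h, hacc, hcof⟩))
  set Y : Set Ordinal.{u} := {c | c ∈ X ∧ ∀ e ∈ E, e ≤ c} with hYdef
  have hY : #Y < Cardinal.lift.{u + 1} χ := by
    by_contra! h
    obtain ⟨ε, hεd, hcof, hlim⟩ := exists_accumulation_of_le_mk hχ (d := d)
      (fun c hc => hX hc.1) h
    have hacc : AccPt ε (Filter.principal X) :=
      accPt_of_forall_lt (hpos ε hcof) fun a ha => by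
        obtain ⟨y, hy, h⟩ := hlim a ha
        exact ⟨y, hy.1, h⟩
    rcases hεd.eq_or_lt with rfl | h
    · exact hd ⟨hacc, hcof⟩
    · obtain ⟨y, hy, -, hyε⟩ := hlim 0 (hpos ε hcof)
      exact absurd (hy.2 ε ⟨h, hacc, hcof⟩) (not_le.2 hyε)
  refine ⟨D₁ ∪ Y, ?_, ?_, fun c hc => ?_⟩
  · rintro x (hx | hx)
    · exact (hD₁ hx).1
    · exact hX hx.1
  · exact (mk_union_le _ _).trans_lt (add_lt_of_lt hχ.lift.aleph0_le hc₁ hY)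
  · by_cases hcY : ∀ e ∈ E, e ≤ c
    · exact .inl (.inr ⟨hc, hcY⟩)
    · push Not at hcY
      obtain ⟨e, he, hce⟩ := hcY
      obtain ⟨x, hx, hex⟩ := hcof₁ e he
      exact .inr ⟨x, hce.trans_le hex, .inr (.inl hx), (hD₁ hx).2⟩

-- From the square principle to the map ρ

/-- Every set of fewer than `χ` elements is bounded. -/
def IsDirectedBelow (χ : Cardinal.{u}) (B : Type u) [Preorder B] : Prop :=
  ∀ X : Set B, #X < χ → BddAbove X

/-- A sequence witnessing the square principle, extended by small cofinal sets at the ordinals of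
cofinality `< χ`, is controlled. -/
theorem SquareLeft.exists_isControlled {l χ : Cardinal.{u}} (h : SquareLeft l χ)
    (hχ : χ.IsRegular) (hχl : χ ≤ l) {B : Type u} [SemilatticeSup B] (hB : IsDirectedBelow χ B) :
    ∃ C : Ordinal.{u} → Set Ordinal.{u}, IsControlled B C (Order.succ l).ord ∧
      ∀ γ < (Order.succ l).ord, typeLT (C γ) ≤ Ordinal.lift.{u + 1} l.ord := by
  classical
  obtain ⟨C, hC⟩ := h
  choose K hK hKc hKcof using exists_cofinal_mk_eq_cof.{u}
  obtain ⟨C', hC', hK'⟩ : ∃ C' : Ordinal.{u} → Set Ordinal.{u},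
      (∀ γ, χ ≤ γ.cof → C' γ = C γ) ∧ ∀ γ, ¬ χ ≤ γ.cof → C' γ = K γ :=
    ⟨fun γ => if χ ≤ γ.cof then C γ else K γ, fun _ h => if_pos h, fun _ h => if_neg h⟩
  refine ⟨C', ⟨?_, ?_, ?_⟩, ?_⟩
  · intro γ hγ
    by_cases hcof : χ ≤ γ.cof
    · rw [hC' γ hcof]
      exact (hC γ hγ hcof).1
    · rw [hK' γ hcof]
      exact hK γ
  · intro γ hγ
    by_cases hcof : χ ≤ γ.cof
    · rw [hC' γ hcof]
      exact (hC γ hγ hcof).2.2.1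
    · rw [hK' γ hcof]
      exact hKcof γ
  · intro γ hγ d hd
    have hbdd : ∀ D : Set Ordinal.{u}, #D < Cardinal.lift.{u + 1} χ → ∀ f : Ordinal.{u} → B,
        BddAbove (f '' D) := by
      intro D hD f
      refine hB _ ?_
      have := mk_image_le_lift (f := f) (s := D)
      rw [Cardinal.lift_id'.{u, u + 1}] at this
      exact Cardinal.lift_lt.1 (this.trans_lt hD)
    by_cases hcof : χ ≤ γ.cof
    · rw [hC' γ hcof] at hd ⊢
      obtain ⟨D, hD, hDc, hctl⟩ := exists_small_control hχ (X := C γ ∩ Iio d) inter_subset_right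
      refine ⟨D, hD, hbdd D hDc, fun c hc => ?_⟩
      rcases hctl c hc with h | ⟨e, hce, he, hacc, hecof⟩
      · exact .inl h
      · refine .inr ⟨e, hce, he, ?_⟩
        have hed : e ≤ d := by
          rcases he with rfl | he
          exacts [le_rfl, (hD he).le]
        rw [hC' e hecof, inter_Iio_inter_Iio hed]
        exact (hC γ hγ hcof).2.2.2.2 e
          (hacc.mono (Filter.monotone_principal inter_subset_left)) hecof
    · rw [hK' γ hcof]
      -- Below a point of small cofinality every point of the set is a control point, so no
      -- coherence is needed there.
      refine ⟨K γ ∩ Iio d, inter_subset_right, hbdd _ ?_, fun c hc => .inl hc⟩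
      refine (mk_le_mk_of_subset inter_subset_left).trans_lt ?_
      rw [hKc, Cardinal.lift_lt]
      exact not_le.1 hcof
  · intro γ hγ
    by_cases hcof : χ ≤ γ.cof
    · rw [hC' γ hcof]
      exact (hC γ hγ hcof).2.2.2.1
    · rw [hK' γ hcof, lift_ord]
      refine (lt_ord.2 ?_).le
      rw [card_type, hKc, Cardinal.lift_lt]
      exact (not_le.1 hcof).trans_le hχl

theorem typeLT_inter_Iio_lt {X : Set Ordinal.{u}} {c : Ordinal.{u}} (hc : c ∈ X) :
    typeLT ↥(X ∩ Iio c) < typeLT X := by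
  refine PrincipalSeg.ordinal_type_lt (⟨⟨⟨fun x => ⟨x.1, x.2.1⟩, ?_⟩, ?_⟩, ⟨c, hc⟩, ?_⟩)
  · intro x y h
    exact Subtype.ext (congrArg (fun z : X => z.1) h)
  · intro x y
    rfl
  · intro x
    constructor
    · rintro ⟨y, rfl⟩
      exact y.2.2
    · intro h
      exact ⟨⟨x.1, x.2, h⟩, rfl⟩

theorem injOn_typeLT_inter_Iio (X : Set Ordinal.{u}) :
    InjOn (fun c => typeLT ↥(X ∩ Iio c)) X := by
  have key : ∀ c ∈ X, ∀ d, c < d → typeLT ↥(X ∩ Iio c) < typeLT ↥(X ∩ Iio d) := by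
    intro c hc d hcd
    have := typeLT_inter_Iio_lt (X := X ∩ Iio d) (c := c) ⟨hc, hcd⟩
    rwa [inter_Iio_inter_Iio hcd.le] at this
  intro c hc d hd h
  rcases lt_trichotomy c d with hcd | hcd | hcd
  · exact absurd h (key c hc d hcd).ne
  · exact hcd
  · exact absurd h (key d hd c hcd).ne'

/-- An injection of the order types below `l` into a type of cardinality `l`, composed with the
order type. -/
theorem exists_injOn_inter_Iio {l : Cardinal.{u}} {B : Type u} (hB : #B = l) [Nonempty B] :
    ∃ τ : Set Ordinal.{u} → B, ∀ X : Set Ordinal.{u}, typeLT X ≤ Ordinal.lift.{u + 1} l.ord →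
      InjOn (fun c => τ (X ∩ Iio c)) X := by
  classical
  have hcard : Cardinal.lift.{u} #(Iio (Ordinal.lift.{u + 1} l.ord)) =
      Cardinal.lift.{u + 2} #B := by
    rw [Cardinal.mk_Iio_ordinal, lift_ord, card_ord, hB]
    simp
  obtain ⟨e⟩ := Cardinal.lift_mk_eq'.1 hcard
  refine ⟨fun X => if h : typeLT X < Ordinal.lift.{u + 1} l.ord then e ⟨typeLT X, h⟩ else
    Classical.arbitrary B, fun X hX c hc d hd h => ?_⟩
  dsimp only at h
  rw [dif_pos ((typeLT_inter_Iio_lt hc).trans_le hX),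
    dif_pos ((typeLT_inter_Iio_lt hd).trans_le hX)] at h
  exact injOn_typeLT_inter_Iio X hc hd (congrArg Subtype.val (e.injective h))

/-- `κ` may be singular while counting walks takes unions of regular length; a regular bound chosen
separately for each `q` is enough. -/
theorem exists_isRegular_bound {κ c : Cardinal.{u}} (hκ : ℵ₀ ≤ κ) (hc : c < κ) :
    ∃ θ : Cardinal.{u}, θ.IsRegular ∧ c < θ ∧ θ ≤ κ := by
  rcases lt_or_ge c ℵ₀ with h | h
  · exact ⟨ℵ₀, isRegular_aleph0, h, hκ⟩
  · exact ⟨Order.succ c, isRegular_succ h, Order.lt_succ c, Order.succ_le_of_lt hc⟩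

theorem SquareLeft.exists_locallySmall {l χ κ : Cardinal.{u}} (h : SquareLeft l χ)
    (hχ : χ.IsRegular) (hχl : χ ≤ l) (hκ : ℵ₀ ≤ κ) {B : Type u} [SemilatticeSup B] [OrderBot B]
    (hB : IsDirectedBelow χ B) (hcard : #B = l) (hsmall : ∀ q : B, #(Iic q) < κ) :
    ∃ ρ : Ordinal.{u} → Ordinal.{u} → B, (∀ α, ρ α α = ⊥) ∧ (∀ α, ρ 0 α = ⊥) ∧
      (∀ γ < (Order.succ l).ord, ∀ α β, α ≤ β → β ≤ γ →
        ρ α γ ≤ ρ α β ⊔ ρ β γ ∧ ρ α β ≤ ρ α γ ⊔ ρ β γ) ∧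
      ∀ γ < (Order.succ l).ord, ∀ q : B,
        #{α | α ≤ γ ∧ ρ α γ ≤ q} < Cardinal.lift.{u + 1} κ := by
  classical
  obtain ⟨C, hC, htype⟩ := h.exists_isControlled hχ hχl hB
  obtain ⟨τ, hτ⟩ := exists_injOn_inter_Iio hcard
  -- Resetting the values at 0 to `⊥` keeps both inequalities, since their left sides become `⊥`
  -- when `α = 0` and `β = 0` forces `α = 0`. It adds at most one point to each set being counted.
  refine ⟨fun α β => if α = 0 then ⊥ else walkDist C τ α β, fun α => ?_, fun α => if_pos rfl,
    ?_, ?_⟩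
  · dsimp only
    split_ifs
    exacts [rfl, walkDist_eq_bot C τ le_rfl]
  · intro γ hγ α β hαβ hβγ
    rcases eq_or_ne α 0 with rfl | hα
    · simp
    have hβ : β ≠ 0 := fun h => hα (le_antisymm (h ▸ hαβ) (zero_le))
    simp only [if_neg hα, if_neg hβ]
    exact walkDist_transitive_subadditive τ hC γ hγ α β hαβ hβγ
  · intro γ hγ q
    obtain ⟨θ, hθ, hqθ, hθκ⟩ := exists_isRegular_bound hκ (hsmall q)
    have hθ' : (Cardinal.lift.{u + 1} θ).IsRegular := hθ.lift
    have key := mk_walkDist_le_lt hC hθ' (τ := τ) (q := q) (fun δ hδ => by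
      have hinj : Function.Injective (fun c : {c | c ∈ C δ ∧ τ (C δ ∩ Iio c) ≤ q} =>
          (⟨τ (C δ ∩ Iio c.1), c.2.2⟩ : Iic q)) := fun c d hcd =>
        Subtype.ext (hτ (C δ) (htype δ hδ) c.2.1 d.2.1 (congrArg Subtype.val hcd))
      have := Cardinal.lift_mk_le'.2 ⟨⟨_, hinj⟩⟩
      rw [Cardinal.lift_id'.{u, u + 1}] at this
      exact this.trans_lt (Cardinal.lift_lt.2 hqθ)) γ hγ
    refine lt_of_lt_of_le ?_ (Cardinal.lift_le.2 hθκ)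
    have hsub : {α | α ≤ γ ∧ (if α = 0 then ⊥ else walkDist C τ α γ) ≤ q} ⊆
        {0} ∪ ({γ} ∪ {α | α < γ ∧ walkDist C τ α γ ≤ q}) := by
      rintro α ⟨h1, h2⟩
      split_ifs at h2 with h
      · exact .inl h
      · rcases h1.eq_or_lt with rfl | h1
        exacts [.inr (.inl rfl), .inr (.inr ⟨h1, h2⟩)]
    have h1 : (1 : Cardinal) < Cardinal.lift.{u + 1} θ := one_lt_aleph0.trans_le hθ'.aleph0_le
    refine (mk_le_mk_of_subset hsub).trans_lt ((mk_union_le _ _).trans_lt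
      (add_lt_of_lt hθ'.aleph0_le ?_ ((mk_union_le _ _).trans_lt
      (add_lt_of_lt hθ'.aleph0_le ?_ key))))
    · rwa [mk_singleton]
    · rwa [mk_singleton]

-- The join-semilattice induced by ρ

/-- Transitivity and subadditivity of `ρ`, together with the convention `ρ(α, α) = 0`. -/
structure IsTransitiveSubadditive {A : Type u} {B : Type v} [LinearOrder A] [SemilatticeSup B]
    (ρ : A → A → B) : Prop where
  isBot_self : ∀ α, IsBot (ρ α α)
  le_sup : ∀ α β δ, α ≤ β → β ≤ δ → ρ α δ ≤ ρ α β ⊔ ρ β δ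
  subadditive : ∀ α β δ, α ≤ β → β ≤ δ → ρ α β ≤ ρ α δ ⊔ ρ β δ

/-- The product `A × B`, to be ordered by `InducedLE ρ`. -/
def InducedProd {A : Type u} {B : Type v} (_ρ : A → A → B) : Type (max u v) := A × B

section Induced

variable {A : Type u} {B : Type v} [LinearOrder A] [SemilatticeSup B] {ρ : A → A → B}

/-- The join-semilattice `(A × B, ⊴_ρ)`. -/
@[reducible]
def IsTransitiveSubadditive.semilatticeSup (h : IsTransitiveSubadditive ρ) : SemilatticeSup (InducedProd ρ) where
  le := InducedLE ρ
  le_refl x := ⟨le_rfl, sup_le le_rfl (h.isBot_self _ _)⟩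
  le_trans x y z hxy hyz := by
    refine ⟨hxy.1.trans hyz.1, sup_le ?_ ?_⟩
    · exact (le_sup_left.trans hxy.2).trans (le_sup_left.trans hyz.2)
    · refine (h.le_sup _ _ _ hxy.1 hyz.1).trans (sup_le ?_ (le_sup_right.trans hyz.2))
      exact (le_sup_right.trans hxy.2).trans (le_sup_left.trans hyz.2)
  le_antisymm x y hxy hyx := Prod.ext (le_antisymm hxy.1 hyx.1)
    (le_antisymm (le_sup_left.trans hxy.2) (le_sup_left.trans hyx.2))
  -- Subadditivity is what puts the term ρ(min, max) below every common upper bound.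
  sup x y := (max x.1 y.1, (x.2 ⊔ y.2) ⊔ ρ (min x.1 y.1) (max x.1 y.1))
  le_sup_left x y := by
    refine ⟨le_max_left _ _, sup_le (le_sup_of_le_left le_sup_left) ?_⟩
    rcases le_total x.1 y.1 with hxy | hxy
    · simp only [max_eq_right hxy, min_eq_left hxy]
      exact le_sup_right
    · simp only [max_eq_left hxy]
      exact h.isBot_self _ _
  le_sup_right x y := by
    refine ⟨le_max_right _ _, sup_le (le_sup_of_le_left le_sup_right) ?_⟩
    rcases le_total x.1 y.1 with hxy | hxy
    · simp only [max_eq_right hxy]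
      exact h.isBot_self _ _
    · simp only [max_eq_left hxy, min_eq_right hxy]
      exact le_sup_right
  sup_le x y z hxz hyz := by
    obtain ⟨hx1, hx2⟩ := hxz
    obtain ⟨hy1, hy2⟩ := hyz
    rw [sup_le_iff] at hx2 hy2
    refine ⟨max_le hx1 hy1, sup_le (sup_le (sup_le hx2.1 hy2.1) ?_) ?_⟩
    · rcases le_total x.1 y.1 with hxy | hxy
      · simp only [max_eq_right hxy, min_eq_left hxy]
        exact (h.subadditive _ _ _ hxy hy1).trans (sup_le hx2.2 hy2.2)
      · simp only [max_eq_left hxy, min_eq_right hxy]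
        exact (h.subadditive _ _ _ hxy hx1).trans (sup_le hy2.2 hx2.2)
    · rcases le_total x.1 y.1 with hxy | hxy
      · simp only [max_eq_right hxy]
        exact hy2.2
      · simp only [max_eq_left hxy]
        exact hx2.2

/-- Pairwise maxima of first coordinates equal that of the top, so at most one `x i` has a different
first coordinate. Dropping one point leaves a forbidden configuration in a single fibre, which is a
copy of `B`. -/
theorem IsTransitiveSubadditive.mfree (h : IsTransitiveSubadditive ρ) {n : ℕ} (hB : MFree n B) :
    @MFree (n + 1) (InducedProd ρ) h.semilatticeSup := by
  let := h.semilatticeSup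
  rintro ⟨t, x, hx, hlt, hsup⟩
  have hfst : ∀ i j, i ≠ j → max (x i).1 (x j).1 = t.1 := fun i j hij =>
    congrArg Prod.fst (hsup i j hij)
  have hsnd : ∀ i j, i ≠ j → ((x i).2 ⊔ (x j).2) ⊔ ρ (min (x i).1 (x j).1) (max (x i).1 (x j).1)
      = t.2 := fun i j hij => congrArg Prod.snd (hsup i j hij)
  obtain ⟨i₀, hi₀⟩ : ∃ i₀, ∀ j, j ≠ i₀ → (x j).1 = t.1 := by
    by_cases hex : ∃ i₀, (x i₀).1 ≠ t.1
    · obtain ⟨i₀, hne⟩ := hex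
      refine ⟨i₀, fun j hj => ?_⟩
      rcases max_choice (x i₀).1 (x j).1 with hm | hm
      · exact absurd (hm.symm.trans (hfst i₀ j hj.symm)) hne
      · exact hm.symm.trans (hfst i₀ j hj.symm)
    · push Not at hex
      exact ⟨0, fun j _ => hex j⟩
  have hfst' : ∀ j, (x (i₀.succAbove j)).1 = t.1 := fun j => hi₀ _ (Fin.succAbove_ne _ _)
  refine hB ⟨t.2, fun j => (x (i₀.succAbove j)).2, fun i j hij => ?_, fun j => ?_,
    fun i j hij => ?_⟩
  · exact Fin.succAbove_right_injective (hx (Prod.ext ((hfst' i).trans (hfst' j).symm) hij))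
  · have hle : InducedLE ρ (x (i₀.succAbove j)) t := (hlt _).le
    refine lt_of_le_of_ne (le_sup_left.trans hle.2) fun he => ?_
    exact (hlt (i₀.succAbove j)).ne (Prod.ext (hfst' j) he)
  · have hne := Fin.succAbove_right_injective (p := i₀).ne hij
    have hs := hsnd _ _ hne
    rw [hfst' i, hfst' j, min_self, max_self, sup_eq_left.2 (h.isBot_self _ _)] at hs
    exact hs

end Induced

theorem isDirectedBelow_induced {A B : Type u} [LinearOrder A] [SemilatticeSup B]
    {ρ : A → A → B} (h : IsTransitiveSubadditive ρ) {χ : Cardinal.{u}} (hA : IsDirectedBelow χ A)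
    (hB : IsDirectedBelow χ B) :
    @IsDirectedBelow χ (InducedProd ρ) h.semilatticeSup.toPreorder := by
  let := h.semilatticeSup
  intro X hX
  obtain ⟨β, hβ⟩ := hA ((fun x : InducedProd ρ => x.1) '' X) (mk_image_le.trans_lt hX)
  -- Once `β` bounds the first coordinates, all elements are lifted to the fibre over `β` and
  -- bounded in `B`.
  obtain ⟨q, hq⟩ := hB ((fun x : InducedProd ρ => x.2 ⊔ ρ x.1 β) '' X) (mk_image_le.trans_lt hX)
  refine ⟨(β, q), fun x hx => ?_⟩
  exact ⟨hβ ⟨x, hx, rfl⟩, hq ⟨x, hx, rfl⟩⟩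

theorem isDirectedBelow_of_le_cof {A : Type u} [LinearOrder A] {χ : Cardinal.{u}}
    (h : χ ≤ Order.cof A) : IsDirectedBelow χ A := fun _ hX =>
  BddAbove.of_not_isCofinal fun hcof => absurd (hX.trans_le h) (not_lt.2 (Order.cof_le hcof))

-- The induction on n

/-- The properties of a special semiladder carried through the induction. -/
structure IsDirectedSemiladder (κ χ : Cardinal.{u}) (n : ℕ) (B : Type u) [iB : SemilatticeSup B] :
    Prop where
  special : IsSpecialSemiladder κ n B iB
  semiladder : IsSemiladder n κ B
  exists_isBot : ∃ b : B, IsBot b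
  directed : IsDirectedBelow χ B

theorem IsDirectedSemiladder.exists_succ {κ χ : Cardinal.{u}} {n : ℕ} {B : Type u}
    [iB : SemilatticeSup B] (hB : IsDirectedSemiladder κ χ n B) (hκ : ℵ₀ ≤ κ) {γ : Ordinal.{u}}
    (hγ : 0 < γ) (hcof : χ ≤ γ.cof) {ρ : Ordinal.{u} → Ordinal.{u} → B}
    (hself : ∀ α, IsBot (ρ α α)) (hzero : ∀ α, IsBot (ρ 0 α))
    (hρ : ∀ δ < γ, ∀ α β, α ≤ β → β ≤ δ →
      ρ α δ ≤ ρ α β ⊔ ρ β δ ∧ ρ α β ≤ ρ α δ ⊔ ρ β δ)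
    (hsmall : ∀ δ < γ, ∀ q : B, #{α | α ≤ δ ∧ ρ α δ ≤ q} < Cardinal.lift.{u + 1} κ) :
    ∃ (S : Type u) (_ : SemilatticeSup S),
      IsDirectedSemiladder κ χ (n + 1) S ∧ #S = γ.card * #B := by
  let f : γ.ToType ≃o Iio γ := ToType.mk.symm
  let σ : γ.ToType → γ.ToType → B := fun α β => ρ (f α).1 (f β).1
  have hσ : IsTransitiveSubadditive σ := by
    refine ⟨fun α => hself _, fun α β δ h1 h2 => ?_, fun α β δ h1 h2 => ?_⟩
    · exact (hρ _ (f δ).2 _ _ (f.monotone h1) (f.monotone h2)).1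
    · exact (hρ _ (f δ).2 _ _ (f.monotone h1) (f.monotone h2)).2
  let iS := hσ.semilatticeSup
  obtain ⟨b, hb⟩ := hB.exists_isBot
  let o : Iio γ := ⟨0, hγ⟩
  have hsemi : IsSemiladder (n + 1) κ (InducedProd σ) := by
    refine ⟨⟨(f.symm o, b)⟩, hσ.mfree hB.semiladder.mfree, ?_⟩
    intro z
    have hle (x : Iic z) : InducedLE σ x.1 z := x.2
    -- A principal ideal embeds in a product of two sets, small by `hsmall` and by the induction
    -- hypothesis on `B`.
    have hinj : Function.Injective (fun x : Iic z =>
        ((⟨(f x.1.1).1, f.monotone (hle x).1, le_sup_right.trans (hle x).2⟩,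
          ⟨x.1.2, le_sup_left.trans (hle x).2⟩) :
          {α | α ≤ (f z.1).1 ∧ ρ α (f z.1).1 ≤ z.2} × Iic z.2)) := by
      intro x y hxy
      have h1 := congrArg (fun w => w.1.1) hxy
      have h2 := congrArg (fun w => w.2.1) hxy
      exact Subtype.ext (Prod.ext (f.injective (Subtype.ext h1)) h2)
    have hcard := Cardinal.lift_mk_le'.2 ⟨⟨_, hinj⟩⟩
    rw [mk_prod, Cardinal.lift_id'.{u, u + 1}, Cardinal.lift_id'.{u, u + 1}] at hcard
    refine Cardinal.lift_lt.1 (hcard.trans_lt ?_)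
    refine mul_lt_of_lt (by simpa using hκ) (hsmall _ (f z.1).2 z.2) ?_
    exact Cardinal.lift_lt.2 (hB.semiladder.card_Iic_lt z.2)
  refine ⟨InducedProd σ, iS, ⟨⟨hsemi, γ, B, iB, hB.special, fun α β => ρ α.1 β.1, ?_, ?_, ?_, ?_,
    Equiv.prodCongr f.toEquiv (Equiv.refl B), ?_⟩, hsemi, ⟨(f.symm o, b), ?_⟩, ?_⟩, ?_⟩
  · exact fun α β δ h1 h2 => (hρ _ δ.2 _ _ h1.le h2.le).1
  · exact fun α β δ h1 h2 => (hρ _ δ.2 _ _ h1.le h2.le).2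
  · exact fun α => hself _
  · rintro o α ho
    change IsBot (ρ o.1 α.1)
    rw [ho]
    exact hzero _
  · intro x y
    exact and_congr_left' f.le_iff_le.symm
  · intro x
    refine ⟨f.symm_apply_le.2 (zero_le (a := (f x.1).1)), sup_le (hb _) ?_⟩
    have : σ (f.symm o) x.1 = ρ 0 (f x.1).1 := by simp [σ, o]
    rw [this]
    exact hzero _ _
  · refine isDirectedBelow_induced hσ (isDirectedBelow_of_le_cof ?_) hB.directed
    rwa [cof_toType]
  · rw [← mk_toType, mul_def]
    rfl

theorem isDirectedSemiladder_punit {κ χ : Cardinal.{u}} (hκ : ℵ₀ ≤ κ) :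
    IsDirectedSemiladder κ χ 0 PUnit.{u + 1} where
  special := ⟨inferInstance, inferInstance⟩
  semiladder := by
    refine ⟨inferInstance, ?_, fun p => ?_⟩
    · rintro ⟨t, x, -, hlt, -⟩
      exact (hlt 0).ne (Subsingleton.elim _ _)
    · exact (mk_le_one_iff_set_subsingleton.2 subsingleton_of_subsingleton).trans_lt
        (one_lt_aleph0.trans_le hκ)
  exists_isBot := ⟨PUnit.unit, fun _ => le_rfl⟩
  directed := fun _ _ => ⟨PUnit.unit, fun _ _ => le_rfl⟩

theorem le_succPow {κ : Cardinal.{u}} (n : ℕ) : κ ≤ succPow κ n := by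
  induction n with
  | zero => exact le_rfl
  | succ n ih =>
    rw [succPow, Function.iterate_succ_apply']
    exact ih.trans (Order.le_succ _)

theorem exists_isDirectedSemiladder {κ : Cardinal.{u}} (hκ : ℵ₀ ≤ κ) (n : ℕ)
    (h : ∀ m < n, SquareLeft (succPow κ m) κ.ord.cof) :
    ∃ (S : Type u) (_ : SemilatticeSup S),
      IsDirectedSemiladder κ κ.ord.cof (n + 1) S ∧ #S = succPow κ n := by
  have hχ : κ.ord.cof.IsRegular := isRegular_cof (isSuccLimit_ord hκ)
  induction n with
  | zero =>
    -- The base case is the ordinal κ itself: over a one-point semilattice, smallness says that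
    -- proper initial segments of κ have size less than κ.
    obtain ⟨S, iS, hS, hcard⟩ := (isDirectedSemiladder_punit hκ).exists_succ hκ
      (γ := κ.ord) (χ := κ.ord.cof) (by simpa using (aleph0_pos.trans_le hκ)) le_rfl
      (ρ := fun _ _ => PUnit.unit) (fun _ _ => le_rfl) (fun _ _ => le_rfl)
      (fun _ _ _ _ _ _ => ⟨le_rfl, le_rfl⟩) (fun δ hδ q => by
        have : {α : Ordinal.{u} | α ≤ δ ∧ PUnit.unit.{u + 1} ≤ q} ⊆ Iio (Order.succ δ) :=
          fun α hα => Order.lt_succ_of_le hα.1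
        refine (mk_le_mk_of_subset this).trans_lt ?_
        rw [Cardinal.mk_Iio_ordinal, Cardinal.lift_lt, ← lt_ord]
        exact (isSuccLimit_ord hκ).succ_lt hδ)
    refine ⟨S, iS, hS, ?_⟩
    rw [hcard]
    simp [succPow]
  | succ n ih =>
    obtain ⟨B, _, hB, hcardB⟩ := ih fun m hm => h m (hm.trans n.lt_succ_self)
    obtain ⟨b, hb⟩ := hB.exists_isBot
    let : OrderBot B := { bot := b, bot_le := hb }
    have hκn : κ ≤ succPow κ n := le_succPow n
    obtain ⟨ρ, hself, hzero, hρ, hsmall⟩ := (h n n.lt_succ_self).exists_locallySmall hχ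
      ((cof_ord_le κ).trans hκn) hκ hB.directed hcardB hB.semiladder.card_Iic_lt
    have hreg : (Order.succ (succPow κ n)).IsRegular := isRegular_succ (hκ.trans hκn)
    obtain ⟨S, iS, hS, hcard⟩ := hB.exists_succ hκ (γ := (Order.succ (succPow κ n)).ord)
      hreg.ord_pos
      (by rw [hreg.cof_ord]; exact (cof_ord_le κ).trans (hκn.trans (Order.le_succ _)))
      (ρ := ρ) (fun α => (hself α).symm ▸ isBot_bot) (fun α => (hzero α).symm ▸ isBot_bot)
      hρ hsmall
    refine ⟨S, iS, hS, ?_⟩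
    rw [hcard, card_ord, hcardB, succPow, succPow, Function.iterate_succ_apply']
    exact mul_eq_left hreg.aleph0_le (Order.le_succ _) (aleph0_pos.trans_le (hκ.trans hκn)).ne'

theorem theorem1p2 :
    -- for singular `κ`: an `(n + 1, κ)`-semiladder of cardinality `κ^{+n}`
    (∀ (κ : Cardinal.{u}) (n : ℕ), κ.IsSingular →
      (∀ m < n, SquareLeft (succPow κ m) κ.ord.cof) →
        ∃ (P : Type u) (_ : SemilatticeSup P), IsSemiladder (n + 1) κ P ∧ #P = succPow κ n) ∧
    -- for arbitrary infinite `κ`: a special one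
    (∀ (κ : Cardinal.{u}) (n : ℕ), ℵ₀ ≤ κ →
      (∀ m < n, SquareLeft (succPow κ m) κ.ord.cof) →
        ∃ (S : Type u) (iS : SemilatticeSup S),
          IsSpecialSemiladder κ (n + 1) S iS ∧ #S = succPow κ n) := by
  refine ⟨fun κ n hκ h => ?_, fun κ n hκ h => ?_⟩
  · obtain ⟨S, iS, hS, hcard⟩ := exists_isDirectedSemiladder hκ.aleph0_le n h
    exact ⟨S, iS, hS.semiladder, hcard⟩
  · obtain ⟨S, iS, hS, hcard⟩ := exists_isDirectedSemiladder hκ n h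
    exact ⟨S, iS, hS.special, hcard⟩
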